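/- Let $m\ge 2$ and let $\mathcal{T}$ be the $m$-adic rooted tree, i.e. the graph whose vertices are the finite words over $\{1,\dots,m\}$, with $w$ and $wx$ joined by an edge for every word $w$ and letter $x$; let $\mathrm{Aut}\,\mathcal{T}$ be its group of graph automorphisms. Let $\sigma=(1\,2\,\cdots\,m)$, and let $a,b\in\mathrm{Aut}\,\mathcal{T}$ be the automorphisms defined recursively by $$a(xw)=\begin{cases}\sigma(x)\,w & x\neq m,\\ \sigma(x)\,a(w) & x=m,\end{cases}\qquad b(xw)=\begin{cases}\sigma(x)\,w & x\neq m,\\ \sigma(x)\,b^{-1}(w) & x=m,\end{cases}$$ for every letter $x$ and word $w$ (in wreath notation, $a=(1,\dots,1,a)\sigma$ and $b=(1,\dots,1,b^{-1})\sigma$). Let $H=\langle a,b\rangle\le\mathrm{Aut}\,\mathcal{T}$ be the generalized Brunner–Sidki–Vieira group. **Proposition.** The automorphism group of the abstract group $H$ is its normalizer in $\mathrm{Aut}\,\mathcal{T}$, that is, $\mathrm{Aut}(H)=N_{\mathrm{Aut}\,\mathcal{T}}(H)$, in the sense that the homomorphism $$N_{\mathrm{Aut}\,\mathcal{T}}(H)\to\mathrm{Aut}(H),\qquad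 g\mapsto (h\mapsto ghg^{-1}),$$ is bijective: every automorphism of $H$ is conjugation by exactly one element of $N_{\mathrm{Aut}\,\mathcal{T}}(H)$. -/

import Mathlib

namespace BSV

/-- The `m`-adic tree `𝒯`: the vertices are the finite words in an alphabet with `m` letters, and two
words are adjacent iff one is obtained from the other by appending one letter on the right. -/
def tree (m : ℕ) : SimpleGraph (List (Fin m)) where
  Adj u v := (∃ x, u = v ++ [x]) ∨ (∃ x, v = u ++ [x])
  symm := ⟨fun _ _ h => h.symm⟩
  loopless := ⟨fun u h => by rcases h with ⟨x, hx⟩ | ⟨x, hx⟩ <;> simpa using congrArg List.length hx⟩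

/-- `Aut 𝒯`: the group of graph automorphisms of the `m`-adic tree. -/
abbrev AutT (m : ℕ) : Type := tree m ≃g tree m

/-- A pair of mutually inverse maps on words, each of which sends every one-letter extension of a word
to a one-letter extension of its image, is a graph automorphism of the tree. -/
def mkAut {m : ℕ} (f g : List (Fin m) → List (Fin m))
    (hgf : Function.LeftInverse g f) (hfg : Function.RightInverse g f)
    (hf : ∀ u x, ∃ y, f (u ++ [x]) = f u ++ [y])
    (hg : ∀ u x, ∃ y, g (u ++ [x]) = g u ++ [y]) : AutT m where
  toFun := f
  invFun := g
  left_inv := hgf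
  right_inv := hfg
  map_rel_iff' := by
    have key : ∀ u v, (∃ x, f u = f v ++ [x]) ↔ (∃ x, u = v ++ [x]) := by
      intro u v
      constructor
      · rintro ⟨x, hx⟩
        obtain ⟨y, hy⟩ := hg (f v) x
        rw [← hx, hgf, hgf] at hy
        exact ⟨y, hy⟩
      · rintro ⟨x, rfl⟩
        exact hf v x
    intro u v
    exact or_congr (key u v) (key v u)

/-- The action on words of the generator `a = (1, …, 1, a) σ`, where `σ = finRotate m` is the cycle
`(1 2 … m)`: the word `x w` goes to `σ(x) w` if `x` is not the last letter, and to `σ(x) a(w)` if it is. -/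
def aMap (m : ℕ) : List (Fin m) → List (Fin m)
  | [] => []
  | x :: w => finRotate m x :: if (x : ℕ) + 1 = m then aMap m w else w

/-- The inverse of `aMap`. -/
def aInvMap (m : ℕ) : List (Fin m) → List (Fin m)
  | [] => []
  | y :: w => (finRotate m).symm y ::
      if ((finRotate m).symm y : ℕ) + 1 = m then aInvMap m w else w

/-- The action on words of the generator `b = (1, …, 1, b⁻¹) σ` (`bMap m true`) and of its inverse
(`bMap m false`), by simultaneous recursion: `b` sends `x w` to `σ(x) w` if `x` is not the last letter
and to `σ(x) b⁻¹(w)` if it is. -/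
def bMap (m : ℕ) : Bool → List (Fin m) → List (Fin m)
  | _, [] => []
  | true, x :: w => finRotate m x :: if (x : ℕ) + 1 = m then bMap m false w else w
  | false, y :: w => (finRotate m).symm y ::
      if ((finRotate m).symm y : ℕ) + 1 = m then bMap m true w else w

theorem aInvMap_aMap (m : ℕ) : Function.LeftInverse (aInvMap m) (aMap m) := by
  intro u
  induction u with
  | nil => rfl
  | cons x w ih => by_cases h : (x : ℕ) + 1 = m <;> simp [-finRotate_apply, -finRotate_symm_apply, aMap, aInvMap, h, ih]

theorem aMap_aInvMap (m : ℕ) : Function.RightInverse (aInvMap m) (aMap m) := by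
  intro u
  induction u with
  | nil => rfl
  | cons y w ih =>
    by_cases h : ((finRotate m).symm y : ℕ) + 1 = m <;> simp [-finRotate_apply, -finRotate_symm_apply, aMap, aInvMap, h, ih]

theorem bMap_bMap_not (m : ℕ) (s : Bool) : Function.LeftInverse (bMap m (!s)) (bMap m s) := by
  intro u
  induction u generalizing s with
  | nil => cases s <;> rfl
  | cons x w ih =>
    cases s
    · by_cases h : ((finRotate m).symm x : ℕ) + 1 = m
      · simpa [-finRotate_apply, -finRotate_symm_apply, bMap, h] using ih true
      · simp [-finRotate_apply, -finRotate_symm_apply, bMap, h]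
    · by_cases h : (x : ℕ) + 1 = m
      · simpa [-finRotate_apply, -finRotate_symm_apply, bMap, h] using ih false
      · simp [-finRotate_apply, -finRotate_symm_apply, bMap, h]

theorem aMap_append (m : ℕ) (u : List (Fin m)) (x : Fin m) :
    ∃ y, aMap m (u ++ [x]) = aMap m u ++ [y] := by
  induction u with
  | nil => exact ⟨finRotate m x, by simp [-finRotate_apply, -finRotate_symm_apply, aMap]⟩
  | cons z w ih =>
    obtain ⟨y, hy⟩ := ih
    by_cases h : (z : ℕ) + 1 = m
    · exact ⟨y, by simp [-finRotate_apply, -finRotate_symm_apply, aMap, h, hy]⟩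
    · exact ⟨x, by simp [-finRotate_apply, -finRotate_symm_apply, aMap, h]⟩

theorem aInvMap_append (m : ℕ) (u : List (Fin m)) (x : Fin m) :
    ∃ y, aInvMap m (u ++ [x]) = aInvMap m u ++ [y] := by
  induction u with
  | nil => exact ⟨(finRotate m).symm x, by simp [-finRotate_apply, -finRotate_symm_apply, aInvMap]⟩
  | cons z w ih =>
    obtain ⟨y, hy⟩ := ih
    by_cases h : ((finRotate m).symm z : ℕ) + 1 = m
    · exact ⟨y, by simp [-finRotate_apply, -finRotate_symm_apply, aInvMap, h, hy]⟩
    · exact ⟨x, by simp [-finRotate_apply, -finRotate_symm_apply, aInvMap, h]⟩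

theorem bMap_append (m : ℕ) (s : Bool) (u : List (Fin m)) (x : Fin m) :
    ∃ y, bMap m s (u ++ [x]) = bMap m s u ++ [y] := by
  induction u generalizing s with
  | nil =>
    cases s
    · exact ⟨(finRotate m).symm x, by simp [-finRotate_apply, -finRotate_symm_apply, bMap]⟩
    · exact ⟨finRotate m x, by simp [-finRotate_apply, -finRotate_symm_apply, bMap]⟩
  | cons z w ih =>
    cases s
    · obtain ⟨y, hy⟩ := ih true
      by_cases h : ((finRotate m).symm z : ℕ) + 1 = m
      · exact ⟨y, by simp [-finRotate_apply, -finRotate_symm_apply, bMap, h, hy]⟩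
      · exact ⟨x, by simp [-finRotate_apply, -finRotate_symm_apply, bMap, h]⟩
    · obtain ⟨y, hy⟩ := ih false
      by_cases h : (z : ℕ) + 1 = m
      · exact ⟨y, by simp [-finRotate_apply, -finRotate_symm_apply, bMap, h, hy]⟩
      · exact ⟨x, by simp [-finRotate_apply, -finRotate_symm_apply, bMap, h]⟩

/-- The generator `a`, with `ψ(a) = (1, …, 1, a) σ`. -/
def a (m : ℕ) : AutT m :=
  mkAut (aMap m) (aInvMap m) (aInvMap_aMap m) (aMap_aInvMap m) (aMap_append m) (aInvMap_append m)

/-- The generator `b`, with `ψ(b) = (1, …, 1, b⁻¹) σ`. -/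
def b (m : ℕ) : AutT m :=
  mkAut (bMap m true) (bMap m false) (bMap_bMap_not m true) (bMap_bMap_not m false)
    (bMap_append m true) (bMap_append m false)

/-- The recursion `ψ(a) = (1, …, 1, a) σ`, in terms of the action on words. -/
theorem a_cons (m : ℕ) (x : Fin m) (w : List (Fin m)) :
    a m (x :: w) = finRotate m x :: if (x : ℕ) + 1 = m then a m w else w := rfl

/-- The recursion `ψ(b) = (1, …, 1, b⁻¹) σ`, in terms of the action on words. -/
theorem b_cons (m : ℕ) (x : Fin m) (w : List (Fin m)) :
    b m (x :: w) = finRotate m x :: if (x : ℕ) + 1 = m then (b m)⁻¹ w else w := rfl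

/-- The generalized Brunner–Sidki–Vieira group `H = ⟨a, b⟩ ≤ Aut 𝒯`. -/
def H (m : ℕ) : Subgroup (AutT m) := Subgroup.closure {a m, b m}

end BSV

/-! An automorphism φ of `H` is realized on the tree by recovering vertices from the group structure
(the Lavreniuk–Nekrashevych method). `H` has a descending series K n of characteristic subgroups,
each generated by the `m`-th powers and commutators of elements of the previous term. K n fixes
level n, is level transitive below each vertex of that level, and meets every rigid stabilizer
nontrivially; this is `IsSaturating`.

For v on level n, the subgroup of K n supported below v is normal in K n, and for distinct v these
subgroups commute. Their images under φ inherit both properties. By `not_both_move`, two commuting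
images cannot both act nontrivially below the same vertex of level n, so a finite injection shows
that each image is supported below exactly one vertex p. The map v ↦ p is a tree automorphism
inducing φ by conjugation. It is unique because an element centralizing `H` preserves every rigid
stabilizer, hence fixes every vertex.

The three properties come from the recursion. `H` acts on first letters through the cyclic group
generated by σ, so `m`-th powers and commutators descend a level. The power `a ^ m ^ n` acts as the
odometer `a` below each vertex of level n. Finally, `H` is regular branch over its nontrivial
commutator subgroup. -/

namespace BSV

open scoped commutatorElement

/-! ### Graph automorphisms preserve the root, levels and prefixes -/

section TreeAutomorphisms

variable {m : ℕ}

@[simp] theorem autT_mul_apply (g h : AutT m) (u : List (Fin m)) : (g * h) u = g (h u) := rfl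

@[simp] theorem autT_one_apply (u : List (Fin m)) : (1 : AutT m) u = u := rfl

@[simp] theorem autT_inv_apply_self (g : AutT m) (u : List (Fin m)) : g⁻¹ (g u) = u :=
  g.symm_apply_apply u

@[simp] theorem autT_apply_inv_self (g : AutT m) (u : List (Fin m)) : g (g⁻¹ u) = u :=
  g.apply_symm_apply u

theorem autT_inv_apply_eq_iff (g : AutT m) {u v : List (Fin m)} : g⁻¹ u = v ↔ g v = u :=
  ⟨fun h => by rw [← h, autT_apply_inv_self], fun h => by rw [← h, autT_inv_apply_self]⟩

theorem exists_apply_ne {g : AutT m} (hg : g ≠ 1) : ∃ u, g u ≠ u := by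
  by_contra! h
  exact hg (RelIso.ext h)

/-- A tree automorphism fixes the root, since the root has fewer neighbours than other vertices. -/
@[simp] theorem autT_apply_nil (g : AutT m) : g [] = [] := by
  by_contra hne
  obtain ⟨v, y, hv⟩ : ∃ v y, g [] = v ++ [y] :=
    ⟨_, _, (List.dropLast_append_getLast hne).symm⟩
  let f : Option (Fin m) → List (Fin m) := fun o => o.elim v fun x => g [] ++ [x]
  have hf : Function.Injective f := by
    rintro (_ | x) (_ | x') h
    · rfl
    · exfalso; simpa [f, hv] using congrArg List.length h
    · exfalso; simpa [f, hv] using congrArg List.length h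
    · simpa [f] using h
  have hadj : ∀ o, (tree m).Adj (g []) (f o) := by
    rintro (_ | x)
    · exact Or.inl ⟨y, hv⟩
    · exact Or.inr ⟨x, rfl⟩
  have hsymm : ∀ o, ∃ x, g⁻¹ (f o) = [x] := by
    intro o
    have h : (tree m).Adj (g⁻¹ (g [])) (g⁻¹ (f o)) := (g⁻¹).map_rel_iff.2 (hadj o)
    rw [autT_inv_apply_self] at h
    rcases h with ⟨x, hx⟩ | ⟨x, hx⟩
    · simpa using congrArg List.length hx
    · exact ⟨x, hx⟩
  choose k hk using hsymm
  have hinj : Function.Injective k := fun o o' h => hf <| (g⁻¹).injective <| by rw [hk, hk, h]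
  simpa using Fintype.card_le_of_injective k hinj

theorem autT_apply_concat (g : AutT m) (u : List (Fin m)) (x : Fin m) :
    ∃ y, g (u ++ [x]) = g u ++ [y] := by
  induction u using List.reverseRecOn generalizing x with
  | nil =>
    rcases g.map_rel_iff.2 (Or.inr ⟨x, rfl⟩ : (tree m).Adj [] ([] ++ [x])) with ⟨y, hy⟩ | h
    · simpa using congrArg List.length hy
    · exact h
  | append_singleton u z ih =>
    rcases g.map_rel_iff.2 (Or.inr ⟨x, rfl⟩ : (tree m).Adj (u ++ [z]) (u ++ [z] ++ [x]))
      with ⟨y, hy⟩ | h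
    -- The image cannot be the parent of `g (u ++ [z])`: by induction that parent is `g u`, against
    -- injectivity.
    · obtain ⟨y', hy'⟩ := ih z
      rw [hy'] at hy
      have := g.injective (List.append_inj_left' hy rfl)
      simpa using congrArg List.length this
    · exact h

@[simp] theorem length_autT_apply (g : AutT m) (u : List (Fin m)) : (g u).length = u.length := by
  induction u using List.reverseRecOn with
  | nil => simp
  | append_singleton u x ih =>
    obtain ⟨y, hy⟩ := autT_apply_concat g u x
    simp [hy, ih]

theorem autT_apply_prefix (g : AutT m) {u v : List (Fin m)} (h : u <+: v) : g u <+: g v := by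
  obtain ⟨t, rfl⟩ := h
  induction t using List.reverseRecOn with
  | nil => simp
  | append_singleton t x ih =>
    obtain ⟨y, hy⟩ := autT_apply_concat g (u ++ t) x
    rw [← List.append_assoc, hy]
    exact ih.trans (List.prefix_append _ _)

theorem eq_of_prefix_of_prefix {u v w : List (Fin m)} (hu : u <+: w) (hv : v <+: w)
    (h : u.length = v.length) : u = v :=
  (List.prefix_of_prefix_length_le hu hv h.le).eq_of_length h

theorem apply_eq_of_apply_eq_of_prefix {g : AutT m} {u v : List (Fin m)} (h : u <+: v)
    (hg : g v = v) : g u = u :=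
  eq_of_prefix_of_prefix (hg ▸ autT_apply_prefix g h) h (by simp)

theorem autT_apply_append (g : AutT m) (u t : List (Fin m)) :
    ∃ s, g (u ++ t) = g u ++ s ∧ s.length = t.length := by
  obtain ⟨s, hs⟩ := autT_apply_prefix g (List.prefix_append u t)
  refine ⟨s, hs.symm, ?_⟩
  simpa using congrArg List.length hs

end TreeAutomorphisms

/-! ### Rigid stabilizers -/

section RigidStabilizers

variable {m : ℕ}

/-- The rigid stabilizer of the vertex `v`: the automorphisms that move only vertices below `v`. -/
def rist (v : List (Fin m)) : Subgroup (AutT m) where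
  carrier := {g | ∀ u, ¬ v <+: u → g u = u}
  one_mem' := fun _ _ => rfl
  mul_mem' := fun hg hh u hu => by rw [autT_mul_apply, hh u hu, hg u hu]
  inv_mem' := fun hg u hu => by rw [autT_inv_apply_eq_iff, hg u hu]

theorem apply_self_of_mem_rist {v : List (Fin m)} {g : AutT m} (hg : g ∈ rist v) : g v = v := by
  by_contra h
  refine h (g.injective (hg _ fun hp => h ?_))
  exact (hp.eq_of_length (by simp)).symm

theorem rist_mono {u v : List (Fin m)} (h : u <+: v) : rist v ≤ rist u :=
  fun _ hg w hw => hg w fun hp => hw (h.trans hp)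

theorem exists_append_ne_of_mem_rist {v : List (Fin m)} {g : AutT m} (hg : g ∈ rist v)
    (hne : g ≠ 1) : ∃ t, g (v ++ t) ≠ v ++ t := by
  obtain ⟨u, hu⟩ := exists_apply_ne hne
  obtain ⟨t, rfl⟩ : v <+: u := by
    by_contra h
    exact hu (hg u h)
  exact ⟨t, hu⟩

theorem eq_of_mem_rist_of_mem_rist {u v : List (Fin m)} {g : AutT m} (hu : g ∈ rist u)
    (hv : g ∈ rist v) (hne : g ≠ 1) (h : u.length = v.length) : u = v := by
  obtain ⟨w, hw⟩ := exists_apply_ne hne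
  refine eq_of_prefix_of_prefix (w := w) ?_ ?_ h
  · by_contra hp
    exact hw (hu w hp)
  · by_contra hp
    exact hw (hv w hp)

theorem conj_mem_rist {v : List (Fin m)} {g : AutT m} (hg : g ∈ rist v) (h : AutT m) :
    h * g * h⁻¹ ∈ rist (h v) := by
  intro u hu
  have : g (h⁻¹ u) = h⁻¹ u := hg _ fun hp => hu (by simpa using autT_apply_prefix h hp)
  simp [this]

end RigidStabilizers

/-! ### Automorphisms of a group with a saturating series are induced by the tree -/

/-- A descending sequence of characteristic subgroups of `G ≤ Aut 𝒯`, the `n`-th of which fixes the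
`n`-th level, is level transitive below each vertex of the `n`-th level, and has nontrivial rigid
stabilizers. -/
structure IsSaturating {m : ℕ} (G : Subgroup (AutT m)) (K : ℕ → Subgroup G) : Prop where
  characteristic : ∀ n (φ : G ≃* G), ∀ k ∈ K n, φ k ∈ K n
  antitone : Antitone K
  fixes : ∀ n, ∀ k ∈ K n, ∀ v : List (Fin m), v.length = n → (k : AutT m) v = v
  transitive : ∀ n (v s t : List (Fin m)), v.length = n → s.length = t.length →
    ∃ k ∈ K n, (k : AutT m) (v ++ s) = v ++ t
  exists_rist : ∀ n (v : List (Fin m)), ∃ k ∈ K n, (k : AutT m) ∈ rist v ∧ k ≠ 1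

namespace IsSaturating

variable {m : ℕ} {G : Subgroup (AutT m)} {K : ℕ → Subgroup G}

theorem conj_mem (hK : IsSaturating G K) {n : ℕ} {k : G} (hk : k ∈ K n) (h : G) :
    h * k * h⁻¹ ∈ K n :=
  hK.characteristic n (MulAut.conj h) k hk

theorem fixes_of_le (hK : IsSaturating G K) {n : ℕ} {k : G} (hk : k ∈ K n) {v : List (Fin m)}
    (hv : v.length ≤ n) : (k : AutT m) v = v :=
  hK.fixes _ k (hK.antitone hv hk) v rfl

/-- A tree automorphism commuting with the elements of a normal subgroup `B` of `K n` agrees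
below `w` with each element of `B` moving `w`, if it moves `w` itself. -/
theorem apply_append_eq_of_commute (hK : IsSaturating G K) {n : ℕ} {B : Set G}
    (hB : ∀ g ∈ B, ∀ k ∈ K n, ⁅k, g⁆ ∈ B) {z : AutT m} (hz : ∀ g ∈ B, Commute z (g : AutT m))
    {g : G} (hg : g ∈ B) {w : List (Fin m)} (hgw : (g : AutT m) w ≠ w) (hzw : z w ≠ w)
    (t : List (Fin m)) : z (w ++ t) = (g : AutT m) (w ++ t) := by
  -- The commutator `⁅r, g⁆` acts as `r` below `w ++ t` and otherwise moves only vertices below `g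
  -- (w ++ t)`. Since `z` commutes with it, `z` sends a moved vertex `y` to a moved vertex; as `z`
  -- moves `w`, that vertex lies below `g (w ++ t)`.
  obtain ⟨r, hrK, hr, hr1⟩ := hK.exists_rist n (w ++ t)
  obtain ⟨s, hs⟩ := exists_append_ne_of_mem_rist hr (by simpa using hr1)
  set y := w ++ t ++ s with hy
  have hwy : w <+: y := by simp [hy]
  have hcy : ((⁅r, g⁆ : G) : AutT m) y = (r : AutT m) y := by
    have : (r : AutT m)⁻¹ ((g : AutT m)⁻¹ y) = (g : AutT m)⁻¹ y := by
      refine (rist (w ++ t)).inv_mem hr _ fun hp => hgw ?_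
      have h1 := autT_apply_prefix (g : AutT m) ((List.prefix_append w t).trans hp)
      rw [autT_apply_inv_self] at h1
      exact eq_of_prefix_of_prefix h1 hwy (by simp)
    simp [commutatorElement_def, this]
  have hcz : ((⁅r, g⁆ : G) : AutT m) (z y) ≠ z y := by
    have := DFunLike.congr_fun (hz _ (hB g hg r hrK)).eq y
    rw [autT_mul_apply, autT_mul_apply, hcy] at this
    rw [← this]
    exact fun h => hs (z.injective h)
  have hwt : w ++ t <+: y := List.prefix_append _ _
  have hpre : (g : AutT m) (w ++ t) <+: z y := by
    by_contra hp
    refine hcz ?_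
    have h1 : (r : AutT m)⁻¹ ((g : AutT m)⁻¹ (z y)) = (g : AutT m)⁻¹ (z y) := by
      refine (rist (w ++ t)).inv_mem hr _ fun hp' => hp ?_
      simpa using autT_apply_prefix (g : AutT m) hp'
    have h2 : (r : AutT m) (z y) = z y := by
      refine hr _ fun hp' => hzw ?_
      exact eq_of_prefix_of_prefix (autT_apply_prefix z hwy)
        ((List.prefix_append w t).trans hp') (by simp)
    simp [commutatorElement_def, h1, h2]
  exact eq_of_prefix_of_prefix (autT_apply_prefix z hwt) hpre (by simp)

/-- If `z` moved `x ++ t`, transitivity would give a conjugate of `g` in `B` moving a vertex `w`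
that `z` moves too. Below `w`, `z` would then agree with every element of `B` moving `w`, but
twisting one of them by a rigid element at `w` changes its action there. -/
theorem not_both_move (hK : IsSaturating G K) {n : ℕ} {B : Subgroup G}
    (hB : ∀ g ∈ B, ∀ k ∈ K n, k * g * k⁻¹ ∈ B) {z : AutT m}
    (hz : ∀ g ∈ B, Commute z (g : AutT m)) {x s t : List (Fin m)} (hx : x.length = n) {g : G}
    (hg : g ∈ B) (hgs : (g : AutT m) (x ++ s) ≠ x ++ s) : z (x ++ t) = x ++ t := by
  by_contra hzt
  -- move `g` to a conjugate that moves a vertex moved by `z`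
  obtain ⟨k, hk, hkw⟩ := hK.transitive n x (s ++ t) (t ++ s) hx (by simp [add_comm])
  set w := x ++ (t ++ s) with hw
  have hzw : z w ≠ w := fun h =>
    hzt (apply_eq_of_apply_eq_of_prefix (by simp [hw, ← List.append_assoc]) h)
  obtain ⟨g', hg', hgw⟩ : ∃ g' ∈ B, (g' : AutT m) w ≠ w := by
    refine ⟨_, hB g hg k hk, fun h => hgs ?_⟩
    have hk' : (k : AutT m)⁻¹ w = x ++ (s ++ t) := by rw [autT_inv_apply_eq_iff, hkw]
    simp only [Subgroup.coe_mul, Subgroup.coe_inv, autT_mul_apply, hk'] at h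
    rw [← hkw] at h
    exact apply_eq_of_apply_eq_of_prefix (by simp [← List.append_assoc])
      ((k : AutT m).injective h)
  have hcomm : ∀ g ∈ B, ∀ k ∈ K n, ⁅k, g⁆ ∈ B := fun g hg k hk =>
    B.mul_mem (hB g hg k hk) (B.inv_mem hg)
  have key := fun {g : G} (hg : g ∈ B) (hgw : (g : AutT m) w ≠ w) =>
    hK.apply_append_eq_of_commute (B := B) hcomm hz hg hgw hzw
  -- Because `g'` carries the subtree at `w` off the support of `r`, the conjugate `r * g' * r⁻¹`
  -- acts below `w` as `g' * r⁻¹`. Both must agree with `z`, so `r` would be trivial there.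
  obtain ⟨r, hrK, hr, hr1⟩ := hK.exists_rist n w
  obtain ⟨u, hu⟩ := exists_append_ne_of_mem_rist hr (by simpa using hr1)
  have hfix : ∀ u, (r : AutT m) ((g' : AutT m) (w ++ u)) = (g' : AutT m) (w ++ u) := fun u =>
    hr _ fun hp => hgw (eq_of_prefix_of_prefix
      (autT_apply_prefix (g' : AutT m) (List.prefix_append w u)) hp (by simp))
  have hrw : (r : AutT m)⁻¹ w = w := apply_self_of_mem_rist ((rist w).inv_mem hr)
  have hconj : ∀ u, ((r * g' * r⁻¹ : G) : AutT m) (w ++ u)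
      = (g' : AutT m) ((r : AutT m)⁻¹ (w ++ u)) := by
    intro u
    obtain ⟨u', hu', -⟩ := autT_apply_append (r : AutT m)⁻¹ w u
    rw [hrw] at hu'
    simp [hu', hfix]
  have hgw' : ((r * g' * r⁻¹ : G) : AutT m) w ≠ w := by
    have := hconj []
    rw [List.append_nil, hrw] at this
    rwa [this]
  have h1 := key (hB g' hg' r hrK) hgw' u
  rw [key hg' hgw u, hconj] at h1
  exact hu ((autT_inv_apply_eq_iff _).1 ((g' : AutT m).injective h1).symm)

/-- An automorphism of `G` permutes the rigid stabilizers in `K n` of the vertices of level `n`. -/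
theorem exists_vertex (hK : IsSaturating G K) (φ : G ≃* G) (v : List (Fin m)) :
    ∃ p : List (Fin m), p.length = v.length ∧
      ∀ k ∈ K v.length, (k : AutT m) ∈ rist v → (φ k : AutT m) ∈ rist p := by
  obtain ⟨n, hn⟩ : ∃ n, v.length = n := ⟨_, rfl⟩
  rw [hn]
  let A : List (Fin m) → Subgroup G := fun v => K n ⊓ (rist v).subgroupOf G
  let B : List (Fin m) → Subgroup G := fun v => (A v).map φ.toMonoidHom
  have hBK : ∀ v, ∀ g ∈ B v, g ∈ K n := by
    rintro v _ ⟨r, hr, rfl⟩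
    exact hK.characteristic n φ r hr.1
  have hB : ∀ v : List (Fin m), v.length = n → ∀ g ∈ B v, ∀ k ∈ K n, k * g * k⁻¹ ∈ B v := by
    rintro v hv _ ⟨r, hr, rfl⟩ k hk
    -- Conjugation by `k` pulls back under `φ` to conjugation by an element of `K n`, which fixes
    -- `v`.
    have hk' := hK.characteristic n φ.symm k hk
    refine ⟨φ.symm k * r * (φ.symm k)⁻¹, ⟨hK.conj_mem hr.1 _, ?_⟩, by simp⟩
    have := conj_mem_rist hr.2 (φ.symm k : AutT m)
    rwa [hK.fixes n _ hk' v hv] at this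
  have hcomm : ∀ u v : List (Fin m), u.length = n → v.length = n → u ≠ v →
      ∀ z ∈ B u, ∀ g ∈ B v, Commute (z : AutT m) (g : AutT m) := by
    rintro u v hu hv huv _ ⟨r, hr, rfl⟩ _ ⟨s, hs, rfl⟩
    -- The commutator is supported both below `u` and below `v`, which are distinct vertices of one
    -- level.
    have hrs : ⁅r, s⁆ = 1 := by
      by_contra hne
      refine huv (eq_of_mem_rist_of_mem_rist (g := ((⁅r, s⁆ : G) : AutT m)) ?_ ?_
        (by simpa using hne) (hu.trans hv.symm))
      · have h1 := conj_mem_rist ((rist u).inv_mem hr.2) (s : AutT m)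
        rw [hK.fixes n s hs.1 u hu] at h1
        have := (rist u).mul_mem hr.2 h1
        simpa [commutatorElement_def, mul_assoc] using this
      · have h1 := conj_mem_rist hs.2 (r : AutT m)
        rw [hK.fixes n r hr.1 v hv] at h1
        exact (rist v).mul_mem h1 ((rist v).inv_mem hs.2)
    exact ((commutatorElement_eq_one_iff_commute.1 hrs).map φ.toMonoidHom).map G.subtype
  have hex : ∀ v : List.Vector (Fin m) n, ∃ x : List.Vector (Fin m) n, ∃ g ∈ B v.1, ∃ t,
      (g : AutT m) (x.1 ++ t) ≠ x.1 ++ t := by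
    rintro ⟨v, hv⟩
    obtain ⟨r, hrK, hr, hr1⟩ := hK.exists_rist n v
    have hφ : ((φ r : G) : AutT m) ≠ 1 := by simpa using hr1
    obtain ⟨u, hu⟩ := exists_apply_ne hφ
    have hlen : n ≤ u.length := by
      by_contra! h
      exact hu (hK.fixes_of_le (hK.characteristic n φ r hrK) h.le)
    refine ⟨⟨u.take n, by simpa using hlen⟩, φ r, ⟨r, ⟨hrK, hr⟩, rfl⟩, u.drop n, ?_⟩
    simpa using hu
  choose f g hgB t hgt using hex
  have hdisj : ∀ u v x : List.Vector (Fin m) n, u ≠ v → (∃ g ∈ B u.1, ∃ t,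
      (g : AutT m) (x.1 ++ t) ≠ x.1 ++ t) → ∀ z ∈ B v.1, ∀ t, (z : AutT m) (x.1 ++ t) = x.1 ++ t := by
    rintro u v x huv ⟨g, hg, s, hgs⟩ z hz t
    exact hK.not_both_move (hB u.1 u.2)
      (fun g hg => hcomm v.1 u.1 v.2 u.2 (fun h => huv (Subtype.ext h).symm) z hz g hg) x.2 hg hgs
  have hf : Function.Injective f := by
    intro u v huv
    by_contra hne
    exact hgt v (hdisj u v (f v) hne ⟨g u, hgB u, t u, huv ▸ hgt u⟩ _ (hgB v) _)
  -- Every vertex of level `n` is thus claimed by some `B u'`, so `B v` acts trivially below all of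
  -- them except `f v`.
  have hsurj := Finite.surjective_of_injective hf
  refine ⟨(f ⟨v, hn⟩).1, (f ⟨v, hn⟩).2, fun k hk hkv u hu => ?_⟩
  have hkB : φ k ∈ B v := ⟨k, ⟨hk, hkv⟩, rfl⟩
  rcases le_or_gt u.length n with hle | hlt
  · exact hK.fixes_of_le (hBK v _ hkB) hle
  · obtain ⟨u', hu'⟩ := hsurj ⟨u.take n, by simpa using hlt.le⟩
    have hne : u' ≠ ⟨v, hn⟩ := by
      rintro rfl
      rw [hu'] at hu
      exact hu (List.take_prefix n u)
    have := hdisj u' ⟨v, hn⟩ (f u') hne ⟨g u', hgB u', t u', hgt u'⟩ _ hkB (u.drop n)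
    rw [hu'] at this
    simpa using this

/-- The vertex whose rigid stabilizer contains the image under `φ` of the one of `v` in `K`. -/
noncomputable def vertexMap (hK : IsSaturating G K) (φ : G ≃* G) (v : List (Fin m)) :
    List (Fin m) :=
  (hK.exists_vertex φ v).choose

theorem length_vertexMap (hK : IsSaturating G K) (φ : G ≃* G) (v : List (Fin m)) :
    (hK.vertexMap φ v).length = v.length :=
  (hK.exists_vertex φ v).choose_spec.1

theorem map_mem_rist_vertexMap (hK : IsSaturating G K) (φ : G ≃* G) {v : List (Fin m)} {k : G}
    (hk : k ∈ K v.length) (hv : (k : AutT m) ∈ rist v) :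
    (φ k : AutT m) ∈ rist (hK.vertexMap φ v) :=
  (hK.exists_vertex φ v).choose_spec.2 k hk hv

/-- A nontrivial element lies in the rigid stabilizer of at most one vertex per level, so a single
witness `k` determines the image vertex. -/
theorem vertexMap_eq (hK : IsSaturating G K) (φ : G ≃* G) {v p : List (Fin m)}
    (hp : p.length = v.length) {k : G} (hk : k ∈ K v.length) (hv : (k : AutT m) ∈ rist v)
    (hk1 : k ≠ 1) (hkp : (φ k : AutT m) ∈ rist p) : hK.vertexMap φ v = p :=
  eq_of_mem_rist_of_mem_rist (hK.map_mem_rist_vertexMap φ hk hv) hkp (by simpa using hk1)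
    ((hK.length_vertexMap φ v).trans hp.symm)

theorem vertexMap_vertexMap (hK : IsSaturating G K) (φ ψ : G ≃* G) (h : ∀ k, ψ (φ k) = k)
    (v : List (Fin m)) :
    hK.vertexMap ψ (hK.vertexMap φ v) = v := by
  obtain ⟨k, hk, hv, hk1⟩ := hK.exists_rist v.length v
  refine hK.vertexMap_eq ψ (hK.length_vertexMap φ v).symm (k := φ k) ?_
    (hK.map_mem_rist_vertexMap φ hk hv) (by simpa using hk1) (by rwa [h])
  rw [hK.length_vertexMap]
  exact hK.characteristic _ φ k hk

theorem vertexMap_concat (hK : IsSaturating G K) (φ : G ≃* G) (v : List (Fin m)) (x : Fin m) :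
    ∃ y, hK.vertexMap φ (v ++ [x]) = hK.vertexMap φ v ++ [y] := by
  obtain ⟨k, hk, hv, hk1⟩ := hK.exists_rist (v ++ [x]).length (v ++ [x])
  have h1 := hK.map_mem_rist_vertexMap φ hk hv
  have h2 := hK.map_mem_rist_vertexMap φ (hK.antitone (by simp) hk)
    (rist_mono (List.prefix_append v [x]) hv)
  -- A vertex moved by `φ k` lies below both image vertices, so these are comparable.
  obtain ⟨u, hu⟩ := exists_apply_ne (g := (φ k : AutT m)) (by simpa using hk1)
  have p1 : hK.vertexMap φ (v ++ [x]) <+: u := by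
    by_contra hp
    exact hu (h1 u hp)
  have p2 : hK.vertexMap φ v <+: u := by
    by_contra hp
    exact hu (h2 u hp)
  obtain ⟨s, hs⟩ := List.prefix_of_prefix_length_le p2 p1 (by simp [length_vertexMap])
  obtain ⟨y, rfl⟩ : ∃ y, s = [y] := by
    rw [← List.length_eq_one_iff]
    simpa [length_vertexMap] using congrArg List.length hs
  exact ⟨y, hs.symm⟩

/-- The tree automorphism induced by an automorphism of `G`. -/
noncomputable def vertexAut (hK : IsSaturating G K) (φ : G ≃* G) : AutT m :=
  mkAut (hK.vertexMap φ) (hK.vertexMap φ.symm)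
    (hK.vertexMap_vertexMap φ φ.symm φ.symm_apply_apply)
    (hK.vertexMap_vertexMap φ.symm φ φ.apply_symm_apply)
    (hK.vertexMap_concat φ) (hK.vertexMap_concat φ.symm)

/-- Conjugation by `h` carries the rigid stabilizer of `v` to that of `h v`; applying `φ` turns this
into conjugation by `φ h`. -/
theorem vertexAut_mul (hK : IsSaturating G K) (φ : G ≃* G) (h : G) :
    hK.vertexAut φ * (h : AutT m) = (φ h : AutT m) * hK.vertexAut φ := by
  refine RelIso.ext fun v => ?_
  obtain ⟨k, hk, hv, hk1⟩ := hK.exists_rist v.length v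
  have hconj := conj_mem_rist hv (h : AutT m)
  change hK.vertexMap φ ((h : AutT m) v) = (φ h : AutT m) (hK.vertexMap φ v)
  refine hK.vertexMap_eq φ (k := h * k * h⁻¹) ?_ ?_ hconj (by simpa using hk1) ?_
  · simp [length_vertexMap]
  · rw [length_autT_apply]
    exact hK.conj_mem hk h
  · have := conj_mem_rist (hK.map_mem_rist_vertexMap φ hk hv) (φ h : AutT m)
    simpa using this

/-- Every automorphism of a group with a saturating sequence of subgroups is conjugation by exactly
one element of its normalizer in `Aut 𝒯`. -/
theorem normalizerMonoidHom_bijective (hK : IsSaturating G K) :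
    Function.Bijective G.normalizerMonoidHom := by
  constructor
  · rw [← MonoidHom.ker_eq_bot_iff, Subgroup.normalizerMonoidHom_ker, eq_bot_iff]
    intro g hg
    have hcent := Subgroup.mem_centralizer_iff.1 (Subgroup.mem_subgroupOf.1 hg)
    refine Subgroup.mem_bot.2 (Subtype.ext (RelIso.ext fun v => ?_))
    obtain ⟨k, hk, hv, hk1⟩ := hK.exists_rist 0 v
    have h1 := conj_mem_rist hv (g : AutT m)
    rw [← hcent k k.2, mul_inv_cancel_right] at h1
    exact eq_of_mem_rist_of_mem_rist h1 hv (by simpa using hk1) (by simp)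
  · intro φ
    have hconj : ∀ h : G, hK.vertexAut φ * (h : AutT m) * (hK.vertexAut φ)⁻¹ = (φ h : AutT m) :=
      fun h => by rw [hK.vertexAut_mul, mul_inv_cancel_right]
    refine ⟨⟨hK.vertexAut φ, ?_⟩, ?_⟩
    · rw [Subgroup.mem_normalizer_iff]
      intro h
      refine ⟨fun hh => hconj ⟨h, hh⟩ ▸ (φ ⟨h, hh⟩).2, fun hh => ?_⟩
      have := hconj (φ.symm ⟨_, hh⟩)
      rw [MulEquiv.apply_symm_apply] at this
      have := mul_left_cancel (mul_right_cancel this)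
      exact this ▸ (φ.symm ⟨_, hh⟩).2
    · ext1 h
      exact Subtype.ext (hconj h)

end IsSaturating

/-! ### The power-commutator series -/

section PowerCommutatorSeries

variable {G : Type*} [Group G]

/-- The descending series of `G` whose successive quotients are abelian of exponent dividing `m`. -/
def powerCommutatorSeries (G : Type*) [Group G] (m : ℕ) : ℕ → Subgroup G
  | 0 => ⊤
  | n + 1 => Subgroup.closure
      ({g | ∃ h ∈ powerCommutatorSeries G m n, g = h ^ m} ∪
        {g | ∃ h ∈ powerCommutatorSeries G m n, ∃ k ∈ powerCommutatorSeries G m n, g = ⁅h, k⁆})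

theorem pow_mem_powerCommutatorSeries {m n : ℕ} {g : G} (hg : g ∈ powerCommutatorSeries G m n) :
    g ^ m ∈ powerCommutatorSeries G m (n + 1) :=
  Subgroup.subset_closure (Or.inl ⟨g, hg, rfl⟩)

theorem commutator_mem_powerCommutatorSeries {m n : ℕ} {g h : G}
    (hg : g ∈ powerCommutatorSeries G m n) (hh : h ∈ powerCommutatorSeries G m n) :
    ⁅g, h⁆ ∈ powerCommutatorSeries G m (n + 1) :=
  Subgroup.subset_closure (Or.inr ⟨g, hg, h, hh, rfl⟩)

/-- Applied to `a`, this provides the element of the `n`-th term that is transitive below level `n`.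
-/
theorem pow_pow_mem_powerCommutatorSeries (m n : ℕ) (g : G) :
    g ^ m ^ n ∈ powerCommutatorSeries G m n := by
  induction n with
  | zero => exact Subgroup.mem_top _
  | succ n ih =>
    rw [pow_succ, pow_mul]
    exact pow_mem_powerCommutatorSeries ih

theorem powerCommutatorSeries_succ_le (m n : ℕ) :
    powerCommutatorSeries G m (n + 1) ≤ powerCommutatorSeries G m n := by
  refine (Subgroup.closure_le _).2 ?_
  rintro _ (⟨h, hh, rfl⟩ | ⟨h, hh, k, hk, rfl⟩)
  · exact Subgroup.pow_mem _ hh m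
  · exact Subgroup.mul_mem _ (Subgroup.mul_mem _ (Subgroup.mul_mem _ hh hk)
      (Subgroup.inv_mem _ hh)) (Subgroup.inv_mem _ hk)

theorem map_mem_powerCommutatorSeries {m n : ℕ} (φ : G ≃* G) {g : G}
    (hg : g ∈ powerCommutatorSeries G m n) : φ g ∈ powerCommutatorSeries G m n := by
  induction n generalizing g with
  | zero => exact Subgroup.mem_top _
  | succ n ih =>
    suffices h : powerCommutatorSeries G m (n + 1) ≤
        (powerCommutatorSeries G m (n + 1)).comap φ.toMonoidHom from h hg
    refine (Subgroup.closure_le _).2 ?_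
    rintro _ (⟨h, hh, rfl⟩ | ⟨h, hh, k, hk, rfl⟩)
    · simpa using pow_mem_powerCommutatorSeries (ih hh)
    · simpa [map_commutatorElement] using commutator_mem_powerCommutatorSeries (ih hh) (ih hk)

end PowerCommutatorSeries

/-- If the generators commute modulo `N`, then so do all elements of the group they generate. -/
theorem commutator_closure_pair_le {G : Type*} [Group G] {x y : G} {N : Subgroup G}
    (hN : ∀ h ∈ Subgroup.closure {x, y}, ∀ g ∈ N, h * g * h⁻¹ ∈ N) (hxy : ⁅x, y⁆ ∈ N) :
    ⁅Subgroup.closure {x, y}, Subgroup.closure {x, y}⁆ ≤ N := by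
  have swap : ∀ g h : G, ⁅g, h⁆ ∈ N → ⁅h, g⁆ ∈ N := fun g h hgh => by
    rw [← commutatorElement_inv]
    exact N.inv_mem hgh
  have step : ∀ g ∈ Subgroup.closure {x, y}, ⁅g, x⁆ ∈ N → ⁅g, y⁆ ∈ N →
      ∀ h ∈ Subgroup.closure {x, y}, ⁅g, h⁆ ∈ N := by
    intro g hg hgx hgy h hh
    induction hh using Subgroup.closure_induction with
    | mem z hz => rcases hz with rfl | rfl <;> assumption
    | one => simp
    | mul u v hu hv ihu ihv =>
      have : ⁅g, u * v⁆ = ⁅g, u⁆ * (u * ⁅g, v⁆ * u⁻¹) := by simp [commutatorElement_def, mul_assoc]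
      rw [this]
      exact N.mul_mem ihu (hN u hu _ ihv)
    | inv u hu ihu =>
      have : ⁅g, u⁻¹⁆ = u⁻¹ * ⁅g, u⁆⁻¹ * u⁻¹⁻¹ := by simp [commutatorElement_def, mul_assoc]
      rw [this]
      exact hN _ (Subgroup.inv_mem _ hu) _ (N.inv_mem ihu)
  have hx : x ∈ Subgroup.closure {x, y} := Subgroup.subset_closure (by simp)
  have hy : y ∈ Subgroup.closure {x, y} := Subgroup.subset_closure (by simp)
  refine Subgroup.commutator_le.2 fun g hg h hh => step g hg ?_ ?_ h hh
  · exact swap _ _ (step x hx (by simp) hxy g hg)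
  · exact swap _ _ (step y hy (swap _ _ hxy) (by simp) g hg)

/-! ### Odometers and level transitivity -/

section Odometers

variable {m : ℕ}

theorem finRotate_val (x : Fin m) :
    (finRotate m x : ℕ) = if (x : ℕ) + 1 = m then 0 else (x : ℕ) + 1 := by
  cases m with
  | zero => exact x.elim0
  | succ n => simp [-finRotate_apply, coe_finRotate, Fin.ext_iff]

/-- The wreath recursion `g = (1, …, 1, s) σ`. -/
def IsOdometer (g s : AutT m) : Prop :=
  ∀ x w, g (x :: w) = finRotate m x :: if (x : ℕ) + 1 = m then s w else w

theorem IsOdometer.pow_apply_zero {g s : AutT m} (hg : IsOdometer g s) {k : ℕ} (hk : k < m)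
    (w : List (Fin m)) : (g ^ k) (⟨0, by omega⟩ :: w) = ⟨k, hk⟩ :: w := by
  induction k with
  | zero => rfl
  | succ k ih =>
    rw [pow_succ', autT_mul_apply, ih (by omega), hg, if_neg (by simp; omega)]
    congr 1
    ext
    rw [finRotate_val, if_neg (by simp; omega)]

/-- One full turn of the cycle passes the last letter exactly once, so each subtree picks up the
section `s` once. -/
theorem IsOdometer.pow_card_apply {g s : AutT m} (hg : IsOdometer g s) (x : Fin m)
    (w : List (Fin m)) : (g ^ m) (x :: w) = x :: s w := by
  have hm := x.pos
  have h0 : ∀ w, (g ^ m) (⟨0, hm⟩ :: w) = ⟨0, hm⟩ :: s w := by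
    intro w
    have hpow : g ^ m = g * g ^ (m - 1) := by rw [← pow_succ', Nat.sub_add_cancel hm]
    rw [hpow, autT_mul_apply, hg.pow_apply_zero (by omega), hg,
      if_pos (by simp; omega)]
    congr 1
    ext
    rw [finRotate_val, if_pos (by simp; omega)]
  have hx := hg.pow_apply_zero x.isLt
  rw [← Fin.eta x x.isLt, ← hx, ← autT_mul_apply, ← pow_add, add_comm, pow_add, autT_mul_apply,
    h0, hx]

theorem isOdometer_a (m : ℕ) : IsOdometer (a m) (a m) := a_cons m

theorem isOdometer_b (m : ℕ) : IsOdometer (b m) (b m)⁻¹ := b_cons m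

theorem a_mem_H (m : ℕ) : a m ∈ H m := Subgroup.subset_closure (by simp)

theorem b_mem_H (m : ℕ) : b m ∈ H m := Subgroup.subset_closure (by simp)

theorem a_pow_card_pow_apply (k : ℕ) (x : Fin m) (w : List (Fin m)) :
    ((a m ^ m) ^ k) (x :: w) = x :: (a m ^ k) w := by
  induction k with
  | zero => rfl
  | succ k ih => rw [pow_succ', autT_mul_apply, ih, (isOdometer_a m).pow_card_apply, pow_succ',
      autT_mul_apply]

theorem a_pow_pow_apply (n : ℕ) (v w : List (Fin m)) (hv : v.length = n) :
    (a m ^ m ^ n) (v ++ w) = v ++ a m w := by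
  induction n generalizing v with
  | zero => simp [List.length_eq_zero_iff.1 hv]
  | succ n ih =>
    obtain ⟨x, v, rfl⟩ := List.exists_cons_of_length_eq_add_one hv
    rw [pow_succ', pow_mul, List.cons_append, a_pow_card_pow_apply, ih v (by simpa using hv), List.cons_append]

/-- The odometer `a` is transitive on each level. -/
theorem exists_a_pow_apply_eq (hm : 0 < m) (s : List (Fin m)) :
    ∃ k : ℕ, (a m ^ k) (List.replicate s.length ⟨0, hm⟩) = s := by
  induction s with
  | nil => exact ⟨0, rfl⟩
  | cons x s ih =>
    obtain ⟨k, hk⟩ := ih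
    -- `a ^ (m * k)` acts as `a ^ k` on the tail; then `a ^ x` turns the first letter `0` into `x`
    -- without touching the tail.
    refine ⟨x + m * k, ?_⟩
    rw [pow_add, autT_mul_apply, pow_mul, List.length_cons, List.replicate_succ,
      a_pow_card_pow_apply, hk, (isOdometer_a m).pow_apply_zero x.isLt]

theorem exists_zpow_a_apply_eq (hm : 0 < m) {s t : List (Fin m)} (h : s.length = t.length) :
    ∃ k : ℤ, (a m ^ k) s = t := by
  obtain ⟨i, hi⟩ := exists_a_pow_apply_eq hm s
  obtain ⟨j, hj⟩ := exists_a_pow_apply_eq hm t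
  refine ⟨j - i, ?_⟩
  rw [zpow_sub, autT_mul_apply, zpow_natCast, zpow_natCast, ← hj, ← h]
  congr 1
  rw [autT_inv_apply_eq_iff, hi]

end Odometers

/-! ### Sections, and level stabilization by the series -/

section Sections

variable {m : ℕ}

/-- The automorphism `g` fixes the `n`-th level, with all sections there in `H`. -/
def fixingWithSections (m n : ℕ) : Subgroup (AutT m) where
  carrier := {g | ∀ v : List (Fin m), v.length = n → ∃ s ∈ H m, ∀ w, g (v ++ w) = v ++ s w}
  one_mem' := fun _ _ => ⟨1, one_mem _, fun _ => rfl⟩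
  mul_mem' := by
    intro g h hg hh v hv
    obtain ⟨s, hs, hgs⟩ := hg v hv
    obtain ⟨t, ht, hht⟩ := hh v hv
    exact ⟨s * t, mul_mem hs ht, fun w => by simp [hgs, hht]⟩
  inv_mem' := by
    intro g hg v hv
    obtain ⟨s, hs, hgs⟩ := hg v hv
    exact ⟨s⁻¹, inv_mem hs, fun w => by rw [autT_inv_apply_eq_iff, hgs, autT_apply_inv_self]⟩

theorem finRotate_pow_card (m : ℕ) : finRotate m ^ m = 1 := by
  ext1 x
  have hm := x.pos
  have h := (isOdometer_a m).pow_card_apply x []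
  have key : ∀ k (x : Fin m), (a m ^ k) [x] = [(finRotate m ^ k) x] := by
    intro k x
    induction k with
    | zero => rfl
    | succ k ih =>
      rw [pow_succ', autT_mul_apply, ih, pow_succ', a_cons]
      simp [-finRotate_apply]
  rw [key] at h
  simpa using h

/-- The automorphism `g` acts on the first letter by `σ ^ i`, and its sections are in `H`. -/
def ActsBy (m : ℕ) (g : AutT m) (i : ℤ) : Prop :=
  ∀ x, ∃ s ∈ H m, ∀ w, g (x :: w) = (finRotate m ^ i) x :: s w

theorem ActsBy.mul {g h : AutT m} {i j : ℤ} (hg : ActsBy m g i) (hh : ActsBy m h j) :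
    ActsBy m (g * h) (i + j) := by
  intro x
  obtain ⟨t, ht, hht⟩ := hh x
  obtain ⟨s, hs, hgs⟩ := hg ((finRotate m ^ j) x)
  exact ⟨s * t, mul_mem hs ht, fun w => by rw [autT_mul_apply, hht, hgs, zpow_add]; rfl⟩

theorem ActsBy.inv {g : AutT m} {i : ℤ} (hg : ActsBy m g i) : ActsBy m g⁻¹ (-i) := by
  intro x
  obtain ⟨s, hs, hgs⟩ := hg ((finRotate m ^ (-i)) x)
  refine ⟨s⁻¹, inv_mem hs, fun w => ?_⟩
  rw [autT_inv_apply_eq_iff, hgs, autT_apply_inv_self, zpow_neg]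
  simp

theorem ActsBy.one : ActsBy m 1 0 := fun _ => ⟨1, one_mem _, fun _ => rfl⟩

theorem ActsBy.pow {g : AutT m} {i : ℤ} (hg : ActsBy m g i) (n : ℕ) : ActsBy m (g ^ n) (i * n) := by
  induction n with
  | zero => simpa using ActsBy.one
  | succ n ih =>
    rw [pow_succ, Nat.cast_succ, mul_add, mul_one]
    exact ih.mul hg

theorem IsOdometer.actsBy {g s : AutT m} (hg : IsOdometer g s) (hs : s ∈ H m) : ActsBy m g 1 := by
  intro x
  by_cases h : (x : ℕ) + 1 = m
  · exact ⟨s, hs, fun w => by rw [hg, if_pos h, zpow_one]⟩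
  · exact ⟨1, one_mem _, fun w => by rw [hg, if_neg h, zpow_one]; rfl⟩

/-- The elements of `H` act on the first letter by powers of `σ`, and their sections are in `H`. -/
theorem exists_actsBy {g : AutT m} (hg : g ∈ H m) : ∃ i, ActsBy m g i := by
  induction hg using Subgroup.closure_induction with
  | mem z hz =>
    rcases hz with rfl | rfl
    · exact ⟨1, (isOdometer_a m).actsBy (a_mem_H m)⟩
    · exact ⟨1, (isOdometer_b m).actsBy (inv_mem (b_mem_H m))⟩
  | one => exact ⟨0, ActsBy.one⟩
  | mul u v _ _ ihu ihv =>
    obtain ⟨i, hi⟩ := ihu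
    obtain ⟨j, hj⟩ := ihv
    exact ⟨_, hi.mul hj⟩
  | inv u _ ihu =>
    obtain ⟨i, hi⟩ := ihu
    exact ⟨_, hi.inv⟩

theorem ActsBy.mem_fixingWithSections {g : AutT m} (hg : ActsBy m g 0) :
    g ∈ fixingWithSections m 1 := by
  intro v hv
  obtain ⟨x, rfl⟩ := List.length_eq_one_iff.1 hv
  obtain ⟨s, hs, h⟩ := hg x
  exact ⟨s, hs, fun w => by simpa using h w⟩

/-- The action on first letters factors through powers of σ, which commute and satisfy `σ ^ m = 1`.
-/
theorem pow_card_mem_fixingWithSections {g : AutT m} (hg : g ∈ H m) :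
    g ^ m ∈ fixingWithSections m 1 := by
  obtain ⟨i, hi⟩ := exists_actsBy hg
  have h := hi.pow m
  refine ActsBy.mem_fixingWithSections fun x => ?_
  obtain ⟨s, hs, hx⟩ := h x
  refine ⟨s, hs, fun w => ?_⟩
  rw [hx, mul_comm, zpow_mul, zpow_natCast, finRotate_pow_card, one_zpow, zpow_zero]

theorem commutator_mem_fixingWithSections {g h : AutT m} (hg : g ∈ H m) (hh : h ∈ H m) :
    ⁅g, h⁆ ∈ fixingWithSections m 1 := by
  obtain ⟨i, hi⟩ := exists_actsBy hg
  obtain ⟨j, hj⟩ := exists_actsBy hh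
  have := ((hi.mul hj).mul hi.inv).mul hj.inv
  rw [show i + j + -i + -j = 0 by ring] at this
  exact this.mem_fixingWithSections

/-- An automorphism whose sections at level `n` fix the first level fixes level `n + 1`. -/
theorem mem_fixingWithSections_succ {n : ℕ} {g : AutT m}
    (hg : ∀ v : List (Fin m), v.length = n →
      ∃ s ∈ fixingWithSections m 1, ∀ w, g (v ++ w) = v ++ s w) :
    g ∈ fixingWithSections m (n + 1) := by
  intro v hv
  obtain ⟨s, hs, hgs⟩ := hg (v.take n) (by simp [hv])
  obtain ⟨t, ht, hst⟩ := hs (v.drop n) (by simp [hv])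
  refine ⟨t, ht, fun w => ?_⟩
  have := hgs (v.drop n ++ w)
  rwa [hst, ← List.append_assoc, ← List.append_assoc, List.take_append_drop] at this

/-- Keeping the sections in `H` makes the induction run: powers and commutators of elements fixing
level `n` have as sections powers and commutators of elements of `H`, which fix one more level. -/
theorem mem_fixingWithSections_of_mem_series {n : ℕ} {g : H m}
    (hg : g ∈ powerCommutatorSeries (H m) m n) : (g : AutT m) ∈ fixingWithSections m n := by
  induction n generalizing g with
  | zero =>
    intro v hv
    rw [List.length_eq_zero_iff.1 hv]
    exact ⟨g, g.2, fun w => rfl⟩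
  | succ n ih =>
    suffices h : powerCommutatorSeries (H m) m (n + 1) ≤
        (fixingWithSections m (n + 1)).subgroupOf (H m) from h hg
    refine (Subgroup.closure_le _).2 ?_
    rintro _ (⟨h, hh, rfl⟩ | ⟨h, hh, k, hk, rfl⟩)
    · refine mem_fixingWithSections_succ fun v hv => ?_
      obtain ⟨s, hs, hhs⟩ := ih hh v hv
      refine ⟨s ^ m, pow_card_mem_fixingWithSections hs, fun w => ?_⟩
      have key : ∀ k w, ((h : AutT m) ^ k) (v ++ w) = v ++ (s ^ k) w := by
        intro k
        induction k with
        | zero => exact fun w => rfl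
        | succ k ihk => intro w; rw [pow_succ, autT_mul_apply, hhs, ihk, pow_succ, autT_mul_apply]
      exact key m w
    · refine mem_fixingWithSections_succ fun v hv => ?_
      obtain ⟨s, hs, hhs⟩ := ih hh v hv
      obtain ⟨t, ht, hkt⟩ := ih hk v hv
      refine ⟨⁅s, t⁆, commutator_mem_fixingWithSections hs ht, fun w => ?_⟩
      have hs' : ∀ w, (h : AutT m)⁻¹ (v ++ w) = v ++ s⁻¹ w := fun w => by
        rw [autT_inv_apply_eq_iff, hhs, autT_apply_inv_self]
      have ht' : ∀ w, (k : AutT m)⁻¹ (v ++ w) = v ++ t⁻¹ w := fun w => by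
        rw [autT_inv_apply_eq_iff, hkt, autT_apply_inv_self]
      simp [commutatorElement_def, hhs, hkt, hs', ht']

end Sections

/-! ### Regular branching over the commutator subgroup -/

section Branching

variable {m : ℕ}

/-- The automorphism `k` acts as `g` on the subtree below the letter `x`, and trivially elsewhere. -/
def IsLift (x : Fin m) (g k : AutT m) : Prop :=
  ∀ y w, k (y :: w) = if y = x then y :: g w else y :: w

theorem IsLift.apply_self {x : Fin m} {g k : AutT m} (h : IsLift x g k) (w : List (Fin m)) :
    k (x :: w) = x :: g w := by rw [h, if_pos rfl]

theorem IsLift.one (x : Fin m) : IsLift x 1 1 := fun y w => by simp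

theorem IsLift.mul {x : Fin m} {g g' k k' : AutT m} (h : IsLift x g k) (h' : IsLift x g' k') :
    IsLift x (g * g') (k * k') := by
  intro y w
  by_cases hy : y = x <;> simp [h y, h' y, hy, h.apply_self, h'.apply_self]

theorem IsLift.inv {x : Fin m} {g k : AutT m} (h : IsLift x g k) : IsLift x g⁻¹ k⁻¹ := by
  intro y w
  rw [autT_inv_apply_eq_iff]
  by_cases hy : y = x <;> simp [h y, hy, h.apply_self]

/-- Every element of `H` is the section at all letters of some element of `H`. -/
theorem exists_diagonal {g : AutT m} (hg : g ∈ H m) :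
    ∃ k ∈ H m, ∀ (x : Fin m) w, k (x :: w) = x :: g w := by
  induction hg using Subgroup.closure_induction with
  | mem z hz =>
    rcases hz with rfl | rfl
    · exact ⟨_, pow_mem (a_mem_H m) m, (isOdometer_a m).pow_card_apply⟩
    · refine ⟨_, inv_mem (pow_mem (b_mem_H m) m), fun x w => ?_⟩
      rw [autT_inv_apply_eq_iff, (isOdometer_b m).pow_card_apply, autT_inv_apply_self]
  | one => exact ⟨1, one_mem _, fun x w => rfl⟩
  | mul u v _ _ ihu ihv =>
    obtain ⟨i, hi, hu⟩ := ihu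
    obtain ⟨j, hj, hv⟩ := ihv
    exact ⟨_, mul_mem hi hj, fun x w => by simp [hu, hv]⟩
  | inv u _ ihu =>
    obtain ⟨i, hi, hu⟩ := ihu
    exact ⟨_, inv_mem hi, fun x w => by rw [autT_inv_apply_eq_iff, hu, autT_apply_inv_self]⟩

theorem IsLift.conj {x : Fin m} {g k h d : AutT m} (hk : IsLift x g k)
    (hd : ∀ (x : Fin m) w, d (x :: w) = x :: h w) : IsLift x (h * g * h⁻¹) (d * k * d⁻¹) := by
  have hd' : ∀ (x : Fin m) w, d⁻¹ (x :: w) = x :: h⁻¹ w := fun x w => by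
    rw [autT_inv_apply_eq_iff, hd, autT_apply_inv_self]
  intro y w
  by_cases hy : y = x <;> simp [hd, hd', hk y, hy, hk.apply_self]

/-- The rotations cancel in `a * b⁻¹`, leaving `(ab, 1, …, 1)`. Conjugation by `a ^ x` transports
this to the letter `x`, since `a ^ x` sends `0 w` to `x w` with the tail unchanged. -/
theorem exists_isLift_mul (x : Fin m) : ∃ k ∈ H m, IsLift x (a m * b m) k := by
  have hm := x.pos
  have h0 : IsLift ⟨0, hm⟩ (a m * b m) (a m * (b m)⁻¹) := by
    intro y w
    obtain ⟨z, rfl⟩ := (finRotate m).surjective y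
    by_cases hz : (z : ℕ) + 1 = m
    · have : finRotate m z = ⟨0, hm⟩ := by ext; rw [finRotate_val, if_pos hz]
      have hb : (b m)⁻¹ (finRotate m z :: w) = z :: b m w := by
        rw [autT_inv_apply_eq_iff, b_cons, if_pos hz, autT_inv_apply_self]
      rw [autT_mul_apply, hb, a_cons, if_pos hz, if_pos this, autT_mul_apply]
    · have : finRotate m z ≠ ⟨0, hm⟩ := by
        intro h
        have := congrArg Fin.val h
        rw [finRotate_val, if_neg hz] at this
        simp at this
      have hb : (b m)⁻¹ (finRotate m z :: w) = z :: w := by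
        rw [autT_inv_apply_eq_iff, b_cons, if_neg hz]
      rw [autT_mul_apply, hb, a_cons, if_neg hz, if_neg this]
  have hx := (isOdometer_a m).pow_apply_zero x.isLt
  have ha := pow_mem (a_mem_H m) (x : ℕ)
  refine ⟨a m ^ (x : ℕ) * (a m * (b m)⁻¹) * (a m ^ (x : ℕ))⁻¹,
    mul_mem (mul_mem ha (mul_mem (a_mem_H m) (inv_mem (b_mem_H m)))) (inv_mem ha), fun y w => ?_⟩
  obtain ⟨z, u, hzu⟩ : ∃ z u, (a m ^ (x : ℕ))⁻¹ (y :: w) = z :: u :=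
    List.exists_cons_of_length_eq_add_one (length_autT_apply _ _)
  rw [autT_mul_apply, hzu, autT_mul_apply, h0]
  rw [autT_inv_apply_eq_iff] at hzu
  by_cases hz : z = ⟨0, hm⟩
  · rw [hz, hx] at hzu
    obtain ⟨rfl, rfl⟩ := List.cons.inj hzu
    rw [hz, if_pos rfl, hx, if_pos rfl]
  · rw [if_neg hz, hzu, if_neg]
    rintro rfl
    have h1 := autT_apply_prefix (a m ^ (y : ℕ)) (List.prefix_append [z] u)
    rw [List.singleton_append, hzu] at h1
    have h2 : (a m ^ (y : ℕ)) [z] = [y] :=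
      eq_of_prefix_of_prefix h1 (List.prefix_append [y] w) (by simp)
    rw [← hx [] , EmbeddingLike.apply_eq_iff_eq] at h2
    exact hz (List.cons.inj h2).1

/-- The elements with a lift in the commutator subgroup form a subgroup `Q`, normalized by `H`
because of the diagonal elements. It contains `⁅a, b⁆`, hence every commutator of `H`. -/
theorem exists_isLift_commutator {g : AutT m} (hg : g ∈ ⁅H m, H m⁆) (x : Fin m) :
    ∃ k ∈ ⁅H m, H m⁆, IsLift x g k := by
  have hnorm : ∀ h ∈ H m, ∀ g ∈ ⁅H m, H m⁆, h * g * h⁻¹ ∈ ⁅H m, H m⁆ := by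
    intro h hh g hg
    have hgH : g ∈ H m := (Subgroup.commutator_le.2 fun u hu v hv =>
      mul_mem (mul_mem (mul_mem hu hv) (inv_mem hu)) (inv_mem hv)) hg
    have := mul_mem (Subgroup.commutator_mem_commutator hh hgH) hg
    simpa [commutatorElement_def] using this
  let Q : Subgroup (AutT m) :=
    { carrier := {g | ∃ k ∈ ⁅H m, H m⁆, IsLift x g k}
      one_mem' := ⟨1, one_mem _, IsLift.one x⟩
      mul_mem' := by
        rintro g h ⟨k, hk, hgk⟩ ⟨l, hl, hhl⟩
        exact ⟨_, mul_mem hk hl, hgk.mul hhl⟩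
      inv_mem' := by
        rintro g ⟨k, hk, hgk⟩
        exact ⟨_, inv_mem hk, hgk.inv⟩ }
  have hQ : ∀ h ∈ H m, ∀ g ∈ Q, h * g * h⁻¹ ∈ Q := by
    rintro h hh g ⟨k, hk, hgk⟩
    obtain ⟨d, hd, hdh⟩ := exists_diagonal hh
    exact ⟨_, hnorm d hd k hk, hgk.conj hdh⟩
  have hab : ⁅a m * b m, a m⁆ ∈ Q := by
    obtain ⟨k, hk, hkl⟩ := exists_isLift_mul x
    obtain ⟨d, hd, hda⟩ := exists_diagonal (a_mem_H m)
    refine ⟨⁅k, d⁆, Subgroup.commutator_mem_commutator hk hd, ?_⟩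
    have := hkl.mul (hkl.inv.conj hda)
    simpa only [commutatorElement_def, mul_assoc] using this
  -- `⁅ab, a⁆ = a ⁅b, a⁆ a⁻¹`, so conjugate by `a⁻¹` and invert.
  have hQab : ⁅a m, b m⁆ ∈ Q := by
    have := Q.inv_mem (hQ _ (inv_mem (a_mem_H m)) _ hab)
    simpa [commutatorElement_def, mul_assoc] using this
  exact commutator_closure_pair_le (N := Q) hQ hQab hg

/-- The group `H` is regular branch over its commutator subgroup. -/
theorem exists_lift_vertex {g : AutT m} (hg : g ∈ ⁅H m, H m⁆) (v : List (Fin m)) :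
    ∃ k ∈ ⁅H m, H m⁆, k ∈ rist v ∧ ∀ w, k (v ++ w) = v ++ g w := by
  induction v with
  | nil => exact ⟨g, hg, fun u hu => absurd List.nil_prefix hu, fun w => rfl⟩
  | cons x v ih =>
    obtain ⟨k, hk, hkv, hkg⟩ := ih
    obtain ⟨l, hl, hlk⟩ := exists_isLift_commutator hk x
    refine ⟨l, hl, fun u hu => ?_, fun w => by simp [hlk x, hkg]⟩
    cases u with
    | nil => simp
    | cons y u =>
      rw [hlk]
      split_ifs with hy
      · subst hy
        rw [hkv u fun hp => hu (by simpa using hp)]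
      · rfl

/-- With letters `0, …, m - 1`, on the word `(m-1)(m-1)0` the product `ab` leaves the third letter
`0`, while `ba` turns it into `1`. The first two letters alone do not separate the images when `m =
2`. -/
theorem commutator_a_b_ne_one (hm : 2 ≤ m) : ⁅a m, b m⁆ ≠ 1 := by
  intro h
  have hab := DFunLike.congr_fun (commutatorElement_eq_one_iff_mul_comm.1 h)
    [⟨m - 1, by omega⟩, ⟨m - 1, by omega⟩, ⟨0, by omega⟩]
  have hlast : ∀ w, a m (⟨m - 1, by omega⟩ :: w) = ⟨0, by omega⟩ :: a m w := fun w => by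
    rw [a_cons, if_pos (by simp; omega)]
    congr 1
    ext
    rw [finRotate_val, if_pos (by simp; omega)]
  have hzero : ∀ w, a m (⟨0, by omega⟩ :: w) = ⟨1, by omega⟩ :: w := fun w => by
    rw [a_cons, if_neg (by simp; omega)]
    congr 1
    ext
    rw [finRotate_val, if_neg (by simp; omega)]
  have hblast : ∀ w, b m (⟨m - 1, by omega⟩ :: w) = ⟨0, by omega⟩ :: (b m)⁻¹ w := fun w => by
    rw [b_cons, if_pos (by simp; omega)]
    congr 1
    ext
    rw [finRotate_val, if_pos (by simp; omega)]
  have hbzero : ∀ w, b m (⟨0, by omega⟩ :: w) = ⟨1, by omega⟩ :: w := fun w => by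
    rw [b_cons, if_neg (by simp; omega)]
    congr 1
    ext
    rw [finRotate_val, if_neg (by simp; omega)]
  have hbinv : (b m)⁻¹ [⟨m - 1, by omega⟩, ⟨0, by omega⟩] = [⟨m - 2, by omega⟩, ⟨0, by omega⟩] := by
    rw [autT_inv_apply_eq_iff, b_cons, if_neg (by simp; omega)]
    congr 1
    ext
    rw [finRotate_val, if_neg (by simp; omega)]
    simp
    omega
  rw [autT_mul_apply, autT_mul_apply, hblast, hbinv, hlast, hlast, hzero, hzero, hbzero] at hab
  simp at hab

end Branching

/-! ### The series of `H` is saturating -/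

/-- A group whose rigid stabilizers are nontrivial has nontrivial rigid stabilizers in all terms of
its power-commutator series. -/
theorem exists_mem_series_mem_rist {m : ℕ} {G : Subgroup (AutT m)}
    (hG : ∀ v : List (Fin m), ∃ k : G, (k : AutT m) ∈ rist v ∧ k ≠ 1) (n : ℕ) (v : List (Fin m)) :
    ∃ k ∈ powerCommutatorSeries G m n, (k : AutT m) ∈ rist v ∧ k ≠ 1 := by
  induction n generalizing v with
  | zero =>
    obtain ⟨k, hk⟩ := hG v
    exact ⟨k, Subgroup.mem_top _, hk⟩
  | succ n ih =>
    obtain ⟨g, hg, hgv, hg1⟩ := ih v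
    obtain ⟨t, ht⟩ := exists_append_ne_of_mem_rist hgv (by simpa using hg1)
    -- As `g` moves `v ++ t`, it conjugates `k` into a different rigid stabilizer of the same level,
    -- so `g` and `k` cannot commute.
    obtain ⟨k, hk, hkv, hk1⟩ := ih (v ++ t)
    refine ⟨⁅g, k⁆, commutator_mem_powerCommutatorSeries hg hk, ?_, fun h => ht ?_⟩
    · have hkv' := rist_mono (List.prefix_append v t) hkv
      exact mul_mem (mul_mem (mul_mem hgv hkv') (inv_mem hgv)) (inv_mem hkv')
    · have h1 : g * k * g⁻¹ = k := by
        rw [commutatorElement_def, mul_inv_eq_one] at h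
        exact h
      have h2 := conj_mem_rist hkv (g : AutT m)
      rw [← Subgroup.coe_inv, ← Subgroup.coe_mul, ← Subgroup.coe_mul, h1] at h2
      exact eq_of_mem_rist_of_mem_rist h2 hkv (by simpa using hk1) (by simp)

theorem isSaturating_powerCommutatorSeries {m : ℕ} (hm : 2 ≤ m) :
    IsSaturating (H m) (powerCommutatorSeries (H m) m) where
  characteristic _ φ _ hk := map_mem_powerCommutatorSeries φ hk
  antitone := antitone_nat_of_succ_le (powerCommutatorSeries_succ_le m)
  fixes n k hk v hv := by
    obtain ⟨s, -, hs⟩ := mem_fixingWithSections_of_mem_series hk v hv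
    simpa using hs []
  transitive n v s t hv hst := by
    obtain ⟨k, hk⟩ := exists_zpow_a_apply_eq (by omega) hst
    refine ⟨_, zpow_mem (pow_pow_mem_powerCommutatorSeries m n ⟨a m, a_mem_H m⟩) k, ?_⟩
    rw [← hk]
    have hpos : ∀ (j : ℕ) w, ((a m ^ m ^ n) ^ j) (v ++ w) = v ++ (a m ^ j) w := by
      intro j
      induction j with
      | zero => exact fun w => rfl
      | succ j ih => intro w; rw [pow_succ, autT_mul_apply, a_pow_pow_apply n v w hv, ih, pow_succ,
          autT_mul_apply]
    cases k with
    | ofNat j => simpa using hpos j s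
    | negSucc j =>
      simp only [zpow_negSucc, Subgroup.coe_inv, Subgroup.coe_pow]
      rw [autT_inv_apply_eq_iff, hpos, autT_apply_inv_self]
  exists_rist := by
    refine exists_mem_series_mem_rist fun v => ?_
    have hD : ⁅a m, b m⁆ ∈ ⁅H m, H m⁆ :=
      Subgroup.commutator_mem_commutator (a_mem_H m) (b_mem_H m)
    have hle : ⁅H m, H m⁆ ≤ H m := Subgroup.commutator_le.2 fun u hu v hv =>
      mul_mem (mul_mem (mul_mem hu hv) (inv_mem hu)) (inv_mem hv)
    obtain ⟨k, hk, hkv, hkg⟩ := exists_lift_vertex hD v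
    refine ⟨⟨k, hle hk⟩, hkv, fun h => commutator_a_b_ne_one hm (RelIso.ext fun w => ?_)⟩
    have h1 : k = 1 := congrArg Subtype.val h
    have := hkg w
    rw [h1, autT_one_apply] at this
    exact (List.append_cancel_left this).symm

end BSV

/-- For every `m ≥ 2`, conjugation `g ↦ (h ↦ g h g⁻¹)` is an isomorphism from the normalizer of the
generalized Brunner–Sidki–Vieira group `H` in `Aut 𝒯` onto the abstract automorphism group of `H`. -/
theorem mainTheorem9 (m : ℕ) (hm : 2 ≤ m) :
    Function.Bijective (BSV.H m).normalizerMonoidHom :=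
  (BSV.isSaturating_powerCommutatorSeries hm).normalizerMonoidHom_bijective
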